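/- Setting. There are $L$ bins and $P$ items. Bin $l$ has a utilization cost $c_l\ge 0$ and a capacity vector $f_l\in\mathbb Z_{\ge 0}^{n_l}$; item $p$ has for bin $l$ a weight vector $r_{lp}\in\{0,1\}^{n_l}$ with consecutive $1$s and a reward $v_{lp}\ge 0$. Item $p$ may be assigned to at most $\rho_p$ bins (a positive integer), at most once to each; $\rho:=\min_p\rho_p$. There are no assignment costs, and $B\ge 0$ is a budget. A feasible solution is an assignment of sets of items to utilized bins such that the items of each bin respect its capacity vector, each item $p$ is assigned to at most $\rho_p$ bins, and the total cost of the utilized bins is at most $B$; its value is the total reward. Let $I_l$ be the family of nonempty item sets $S$ with $\sum_{p\in S}r_{lp}\le f_l$, and let $k:=B/\max\{c_l : I_l\neq\emptyset\}$, where this maximum is assumed to exist and to be positive, and $k\ge 1$. Algorithm 2. 1. Let $\widetilde X$ be an optimal solution of the linear program: maximize $\sum_l\sum_{S\in I_l}X_{lS}\sum_{p\in S}v_{lp}$ subject to $\sum_{S\in I_l}X_{lS}\le 1$ for all $l$, $\sum_l\sum_{S\in I_l:\,p\in S}X_{lS}\le\rho_p$ for all $p$, $\sum_l\sum_{S\in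 I_l}c_lX_{lS}\le B$, and $X_{lS}\in[0,1]$. 2. Order the bins so that the ratios $\frac{\sum_{S\in I_l}\widetilde X_{lS}\sum_{p\in S}v_{lp}}{c_l\sum_{S\in I_l}\widetilde X_{lS}}$ are nonincreasing (with $0/0:=0$, and $a/0:=\infty$ for $a>0$). 3. Independently for each $l$, draw $S_l\in I_l\cup\{\emptyset\}$ with $P(S_l=S)=\widetilde X_{lS}$ for $S\in I_l$ and $P(S_l=\emptyset)=1-\sum_{S\in I_l}\widetilde X_{lS}$. 4. Assign $S_l$ to $l$ for every $l$; then remove each item $p$ that is assigned to more than $\rho_p$ bins from all but $\rho_p$ bins with highest rewards $v_{lp}$ among them. If the total cost of the bins that still have an item is at most $B$, return this assignment. 5. Otherwise start anew: put $B_0:=B$ and, for the bins $l=1,\dots,L$ in the order of step 2, put $B_l:=B_{l-1}-c_l$ if $S_l\ne\emptyset$ and $B_l:=B_{l-1}$ if $S_l=\emptyset$; assign $S_l$ to $l$ if $B_l\ge 0$. Then remove items as in step 4 and return the resulting assignment. In both cases the utilized bins are those with at least one item. Theorem. Whatever optimal solution $\widetilde X$, order of bins with equal ratio, and rule to break ties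 between equal rewards are used, the solution returned by Algorithm 2 is always feasible, and its expected value is at least $$\left(1-\frac1{\sqrt{\rho+3}}\right)\frac{k-1}{k}\left(1-\frac1{\sqrt k}\right)$$ times the optimal value of the linear program in step 1, and hence at least this factor times the largest value of a feasible solution. -/

import Mathlib

open scoped BigOperators ENNReal

noncomputable section

namespace BudgetedAssignment

/-- An instance of the one-dimensional budgeted `ρ`-assignment problem with consecutive unit
weight vectors, with `L` bins and `P` items. -/
structure Inst (L P : ℕ) where
  /-- dimension of the capacity vector of each bin -/
  dim : Fin L → ℕ
  /-- capacity vectors -/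
  cap : (l : Fin L) → Fin (dim l) → ℕ
  /-- weight vectors: `0`-`1` vectors whose `1`s are consecutive -/
  weight : (l : Fin L) → Fin P → Fin (dim l) → ℕ
  weight_binary : ∀ l p i, weight l p i = 0 ∨ weight l p i = 1
  weight_consecutive : ∀ l p, Set.OrdConnected {i | weight l p i = 1}
  /-- reward of assigning an item to a bin -/
  reward : Fin L → Fin P → ℝ
  reward_nonneg : ∀ l p, 0 ≤ reward l p
  /-- utilization cost of a bin -/
  binCost : Fin L → ℝ
  binCost_nonneg : ∀ l, 0 ≤ binCost l
  /-- cost of assigning an item to a bin -/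
  assignCost : Fin L → Fin P → ℝ
  assignCost_nonneg : ∀ l p, 0 ≤ assignCost l p
  /-- the largest number of bins to which an item may be assigned -/
  mult : Fin P → ℕ
  mult_pos : ∀ p, 0 < mult p
  /-- total budget -/
  budget : ℝ
  budget_nonneg : 0 ≤ budget

/-- An assignment gives to each bin the set of items assigned to it. -/
abbrev Assignment (L P : ℕ) := Fin L → Finset (Fin P)

variable {L P : ℕ}

/-- The bins to which item `p` is assigned. -/
def binsOf (A : Assignment L P) (p : Fin P) : Finset (Fin L) :=
  Finset.univ.filter (fun l => p ∈ A l)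

/-- The bins to which at least one item is assigned. -/
def openBins (A : Assignment L P) : Finset (Fin L) :=
  Finset.univ.filter (fun l => (A l).Nonempty)

namespace Inst

variable (I : Inst L P)

/-- Total reward of an assignment. -/
def value (A : Assignment L P) : ℝ := ∑ l, ∑ p ∈ A l, I.reward l p

/-- Total cost of an assignment when the bins in `y` are utilized. -/
def totalCost (y : Finset (Fin L)) (A : Assignment L P) : ℝ :=
  (∑ l ∈ y, I.binCost l) + ∑ l, ∑ p ∈ A l, I.assignCost l p

/-- `(y, A)` is a feasible solution: `y` is the set of utilized bins, `A` the assignment. -/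
structure Feasible (y : Finset (Fin L)) (A : Assignment L P) : Prop where
  utilized : ∀ l, (A l).Nonempty → l ∈ y
  capacity : ∀ l i, ∑ p ∈ A l, I.weight l p i ≤ I.cap l i
  multiplicity : ∀ p, (binsOf A p).card ≤ I.mult p
  withinBudget : I.totalCost y A ≤ I.budget

/-- The family of all nonempty sets of items that fit into bin `l`. -/
def configs (l : Fin L) : Finset (Finset (Fin P)) :=
  Finset.univ.filter
    (fun S => S.Nonempty ∧ ∀ i, ∑ p ∈ S, I.weight l p i ≤ I.cap l i)

/-- The cost of utilizing bin `l` with the set `S` of items. -/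
def configCost (l : Fin L) (S : Finset (Fin P)) : ℝ :=
  I.binCost l + ∑ p ∈ S, I.assignCost l p

/-- The budget divided by the largest cost of a configuration. -/
def k : ℝ := I.budget / sSup {c : ℝ | ∃ l, ∃ S ∈ I.configs l, c = I.configCost l S}

/-- The smallest of the multiplicities of the items. -/
def rho : ℕ := ⨅ p, I.mult p

/-- Objective of the configuration linear program. Only the entries `X l S` with
`S ∈ I.configs l` are variables of the program. -/
def lpValue (X : Fin L → Finset (Fin P) → ℝ) : ℝ :=
  ∑ p, ∑ l, ∑ S ∈ (I.configs l).filter (fun S => p ∈ S), I.reward l p * X l S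

/-- Feasibility for the configuration linear program (the relaxation of the configuration
integer program). -/
structure LPFeasible (X : Fin L → Finset (Fin P) → ℝ) : Prop where
  nonneg : ∀ l, ∀ S ∈ I.configs l, 0 ≤ X l S
  le_one : ∀ l, ∀ S ∈ I.configs l, X l S ≤ 1
  one_config : ∀ l, ∑ S ∈ I.configs l, X l S ≤ 1
  multiplicity : ∀ p,
    ∑ l, ∑ S ∈ (I.configs l).filter (fun S => p ∈ S), X l S ≤ (I.mult p : ℝ)
  withinBudget : ∑ l, ∑ S ∈ I.configs l, I.configCost l S * X l S ≤ I.budget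

/-- `X` is an optimal solution of the configuration linear program. -/
def LPOptimal (X : Fin L → Finset (Fin P) → ℝ) : Prop :=
  I.LPFeasible X ∧ ∀ Y, I.LPFeasible Y → I.lpValue Y ≤ I.lpValue X

/-- The reward-to-cost ratio of bin `l`. In `ℝ≥0∞` one has `0 / 0 = 0` and `a / 0 = ∞`
for `a ≠ 0`. -/
def ratio (X : Fin L → Finset (Fin P) → ℝ) (l : Fin L) : ℝ≥0∞ :=
  ENNReal.ofReal (∑ S ∈ I.configs l, X l S * ∑ p ∈ S, I.reward l p) /
    ENNReal.ofReal (I.binCost l * ∑ S ∈ I.configs l, X l S)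

/-- `σ` lists the bins (`σ i` is the bin in position `i`) by nonincreasing ratio. -/
def SortedBy (X : Fin L → Finset (Fin P) → ℝ) (σ : Equiv.Perm (Fin L)) : Prop :=
  ∀ i j, i < j → I.ratio X (σ j) ≤ I.ratio X (σ i)

/-- The probability that the set drawn for bin `l` is `S`. -/
def drawProb (X : Fin L → Finset (Fin P) → ℝ) (l : Fin L) (S : Finset (Fin P)) : ℝ :=
  if S = ∅ then 1 - ∑ S' ∈ I.configs l, X l S'
  else if S ∈ I.configs l then X l S else 0

/-- Expectation of `F` when the sets of the bins are drawn independently, that of bin `l`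
with law `I.drawProb X l`. -/
def expect (X : Fin L → Finset (Fin P) → ℝ) (F : Assignment L P → ℝ) : ℝ :=
  ∑ T : Assignment L P, (∏ l, I.drawProb X l (T l)) * F T

/-- `T` is a possible outcome of the draw: every `T l` is empty or a configuration of `l`. -/
def IsDraw (T : Assignment L P) : Prop := ∀ l, T l ∈ insert ∅ (I.configs l)

/-- `A'` arises from `A` by removing each item `p` that is assigned to more than `I.mult p`
bins from all but `I.mult p` bins with highest reward for `p` (ties are broken arbitrarily),
and by keeping all other items. -/
structure Trim (A A' : Assignment L P) : Prop where
  subset : ∀ p, binsOf A' p ⊆ binsOf A p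
  card_eq : ∀ p, (binsOf A' p).card = min (I.mult p) (binsOf A p).card
  highest : ∀ p, ∀ l ∈ binsOf A' p, ∀ l' ∈ binsOf A p \ binsOf A' p,
    I.reward l' p ≤ I.reward l p

/-- The running budget after the bins in positions up to `j`: it starts at the budget, and in
each position the cost of the bin is subtracted if a configuration was drawn for it. -/
def residual (σ : Equiv.Perm (Fin L)) (T : Assignment L P) (j : Fin L) : ℝ :=
  I.budget - ∑ i ∈ Finset.Iic j,
    I.binCost (σ i) * (if T (σ i) ∈ I.configs (σ i) then 1 else 0)

/-- A bin receives its drawn set if the running budget is nonnegative after this bin. -/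
def greedy (σ : Equiv.Perm (Fin L)) (T : Assignment L P) : Assignment L P :=
  fun l => if 0 ≤ I.residual σ T (σ.symm l) then T l else ∅

/-- `A` is an assignment returned by the algorithm on the draw `T`. First, the whole draw is
trimmed; if the result respects the budget, it is returned. Otherwise, the greedy part of the
draw is trimmed and returned. The utilized bins are those with at least one item. -/
def IsOutput (σ : Equiv.Perm (Fin L)) (T A : Assignment L P) : Prop :=
  ∃ A₁, I.Trim T A₁ ∧
    ((I.totalCost (openBins A₁) A₁ ≤ I.budget ∧ A = A₁) ∨
      (I.budget < I.totalCost (openBins A₁) A₁ ∧ I.Trim (I.greedy σ T) A))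

end Inst

end BudgetedAssignment

end

/-! Let `x l p` be the LP probability that bin `l` draws `p`. Two random quantities control what
survives: `φ l`, the indicator that the nonempty bins before `l` cost at most `k - 1` in units of
the largest configuration cost, and `ψ l p = min 1 (m / (1 + N))`, where `m` is the multiplicity of
`p` and `N` counts the other bins that draw `p`. If `φ l = 1`, bin `l` has its whole set before
trimming in either branch of the algorithm. Trimming keeps the best bins of an item, so at least an
average share of its reward. Hence, pointwise, the value is at least the sum of `reward * [p drawn
by l] * φ l * ψ l p` (`IsOutput.le_value`).

The event that `l` draws `p` is independent of `φ l * ψ l p`, which involves only other bins. Both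
factors decrease when more is drawn, so by Harris' inequality the mean of the product is at least
the product of the means.

Each mean is estimated from the first two moments of a sum of independent `[0,1]`-valued variables,
whose variance is at most their mean, through a concave quadratic minorant. For `ψ` this gives `1 -
1/√(m+3)`. For `φ`, Chebyshev's sum inequality along the sorted order replaces rewards by expected
costs as weights. The cost collected while the prefix is at most `k - 1` is at least `min (total) (k
- 1)`, whose mean is bounded in the same way. -/

namespace BudgetedAssignment

/-! ### Expectations under finite product laws, and correlation inequalities. -/

section ProductExpectation

theorem prod_update_mul {ι α : Type*} [Fintype ι] [DecidableEq ι] (D : ι → α → ℝ) (l : ι) (T : ι → α) (a : α) :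
    (∏ i, D i (Function.update T l a i)) * D l (T l) = (∏ i, D i (T i)) * D l a := by
  rw [← Finset.mul_prod_erase _ _ (Finset.mem_univ l),
    ← Finset.mul_prod_erase Finset.univ (fun i => D i (T i)) (Finset.mem_univ l)]
  have : ∏ i ∈ Finset.univ.erase l, D i (Function.update T l a i)
      = ∏ i ∈ Finset.univ.erase l, D i (T i) :=
    Finset.prod_congr rfl fun i hi => by
      rw [Function.update_of_ne (Finset.ne_of_mem_erase hi)]
  rw [this, Function.update_self]
  ring

variable {ι α : Type*} [Fintype ι] [DecidableEq ι] [Fintype α]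

/-- Expectation of `F` when the coordinates are independent with laws `D i`. -/
noncomputable def prodExpect (D : ι → α → ℝ) (F : (ι → α) → ℝ) : ℝ :=
  ∑ T : ι → α, (∏ i, D i (T i)) * F T

/-- Average of `F` over the coordinate `l`. -/
noncomputable def coordAverage (D : ι → α → ℝ) (l : ι) (F : (ι → α) → ℝ) (T : ι → α) : ℝ :=
  ∑ a, D l a * F (Function.update T l a)

theorem prodExpect_add (D : ι → α → ℝ) (F G : (ι → α) → ℝ) :
    prodExpect D (fun T => F T + G T) = prodExpect D F + prodExpect D G := by
  simp [prodExpect, mul_add, Finset.sum_add_distrib]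

theorem prodExpect_const_mul (D : ι → α → ℝ) (c : ℝ) (F : (ι → α) → ℝ) :
    prodExpect D (fun T => c * F T) = c * prodExpect D F := by
  simp only [prodExpect, Finset.mul_sum]
  exact Finset.sum_congr rfl fun T _ => by ring

theorem prodExpect_sum {κ : Type*} (D : ι → α → ℝ) (s : Finset κ) (F : κ → (ι → α) → ℝ) :
    prodExpect D (fun T => ∑ j ∈ s, F j T) = ∑ j ∈ s, prodExpect D (F j) := by
  simp only [prodExpect, Finset.mul_sum]
  exact Finset.sum_comm

theorem prodExpect_const {D : ι → α → ℝ} (hD : ∀ i, ∑ a, D i a = 1) (c : ℝ) :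
    prodExpect D (fun _ => c) = c := by
  classical
  have h := Finset.prod_univ_sum (fun _ : ι => (Finset.univ : Finset α)) D
  simp only [hD, Finset.prod_const_one, Fintype.piFinset_univ] at h
  simp only [prodExpect]
  rw [← Finset.sum_mul, ← h, one_mul]

theorem prodExpect_mono_of_support {D : ι → α → ℝ} (hD : ∀ i a, 0 ≤ D i a)
    {F G : (ι → α) → ℝ} (h : ∀ T, (∀ i, D i (T i) ≠ 0) → F T ≤ G T) :
    prodExpect D F ≤ prodExpect D G := by
  refine Finset.sum_le_sum fun T _ => ?_
  by_cases hT : ∀ i, D i (T i) ≠ 0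
  · exact mul_le_mul_of_nonneg_left (h T hT) (Finset.prod_nonneg fun i _ => hD i _)
  · push Not at hT
    obtain ⟨i, hi⟩ := hT
    have h0 : ∏ i, D i (T i) = 0 := Finset.prod_eq_zero (Finset.mem_univ i) hi
    simp [h0]

theorem prodExpect_mono {D : ι → α → ℝ} (hD : ∀ i a, 0 ≤ D i a)
    {F G : (ι → α) → ℝ} (h : ∀ T, F T ≤ G T) : prodExpect D F ≤ prodExpect D G :=
  prodExpect_mono_of_support hD fun T _ => h T

/-- Resampling one coordinate preserves the law: exchanging `T l` with an independent copy `a` is an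
involution that preserves the weights. -/
theorem prodExpect_coordAverage {D : ι → α → ℝ} (l : ι) (hD : ∑ a, D l a = 1)
    (F : (ι → α) → ℝ) : prodExpect D (coordAverage D l F) = prodExpect D F := by
  have hinv : Function.Involutive
      (fun x : (ι → α) × α => (Function.update x.1 l x.2, x.1 l)) := by
    rintro ⟨T, a⟩
    simp
  have h1 : prodExpect D F
      = ∑ x : (ι → α) × α, (∏ i, D i (x.1 i)) * D l x.2 * F x.1 := by
    rw [Fintype.sum_prod_type]
    refine Finset.sum_congr rfl fun T _ => ?_
    dsimp only
    rw [← Finset.sum_mul, ← Finset.mul_sum, hD, mul_one]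
  rw [h1, ← Equiv.sum_comp hinv.toPerm, Fintype.sum_prod_type]
  refine Finset.sum_congr rfl fun T _ => ?_
  rw [coordAverage, Finset.mul_sum]
  refine Finset.sum_congr rfl fun a _ => ?_
  change _ = (∏ i, D i (Function.update T l a i)) * D l (T l) * F (Function.update T l a)
  rw [prod_update_mul]
  ring

/-- A function of one coordinate is independent of a function of the others. -/
theorem prodExpect_apply_mul {D : ι → α → ℝ} (l : ι) (hD : ∑ a, D l a = 1) (f : α → ℝ)
    (G : (ι → α) → ℝ) (hG : ∀ T a, G (Function.update T l a) = G T) :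
    prodExpect D (fun T => f (T l) * G T) = (∑ a, D l a * f a) * prodExpect D G := by
  rw [← prodExpect_coordAverage l hD, ← prodExpect_const_mul]
  congr 1
  ext T
  simp only [coordAverage, Function.update_self, hG, Finset.sum_mul]
  exact Finset.sum_congr rfl fun a _ => by ring

theorem prodExpect_apply {D : ι → α → ℝ} (hD : ∀ i, ∑ a, D i a = 1) (l : ι) (f : α → ℝ) :
    prodExpect D (fun T => f (T l)) = ∑ a, D l a * f a := by
  have := prodExpect_apply_mul l (hD l) f (fun _ => 1) (fun _ _ => rfl)
  simpa [prodExpect_const hD] using this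

/-- The second moment of a sum of independent `[0,1]`-valued variables. -/
theorem prodExpect_sq_sum_le {D : ι → α → ℝ} (hD0 : ∀ i a, 0 ≤ D i a)
    (hD : ∀ i, ∑ a, D i a = 1) (s : Finset ι) (h : ι → α → ℝ) (h0 : ∀ i a, 0 ≤ h i a)
    (h1 : ∀ i a, h i a ≤ 1) :
    prodExpect D (fun T => (∑ i ∈ s, h i (T i)) ^ 2)
      ≤ (∑ i ∈ s, ∑ a, D i a * h i a) ^ 2 + ∑ i ∈ s, ∑ a, D i a * h i a := by
  induction s using Finset.induction_on with
  | empty => simp [prodExpect_const hD]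
  | insert l s hl ih =>
    set m := ∑ i ∈ s, ∑ a, D i a * h i a with hm
    set x := ∑ a, D l a * h l a with hx
    have hs : prodExpect D (fun T => ∑ i ∈ s, h i (T i)) = m := by
      rw [prodExpect_sum]
      exact Finset.sum_congr rfl fun i _ => prodExpect_apply hD i (h i)
    have hcross : prodExpect D (fun T => h l (T l) * ∑ i ∈ s, h i (T i)) = x * m := by
      rw [prodExpect_apply_mul l (hD l), hs]
      intro T a
      exact Finset.sum_congr rfl fun i hi => by
        rw [Function.update_of_ne (ne_of_mem_of_not_mem hi hl)]
    have hsq : prodExpect D (fun T => h l (T l) ^ 2) ≤ x := by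
      rw [hx, ← prodExpect_apply hD l]
      exact prodExpect_mono hD0 fun T => by nlinarith [h0 l (T l), h1 l (T l)]
    have hexp : prodExpect D (fun T => (∑ i ∈ insert l s, h i (T i)) ^ 2)
        = prodExpect D (fun T => h l (T l) ^ 2)
          + (2 * (x * m) + prodExpect D (fun T => (∑ i ∈ s, h i (T i)) ^ 2)) := by
      rw [← hcross, ← prodExpect_const_mul, ← prodExpect_add, ← prodExpect_add]
      congr 1
      ext T
      rw [Finset.sum_insert hl]
      ring
    rw [hexp, Finset.sum_insert hl]
    -- The bound has `x ^ 2` to spare, because the second moment of the new variable is at most its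
    -- mean `x`.
    nlinarith [sq_nonneg x]

/-- Chebyshev's association inequality for a law on a set that is totally preordered by `r`. -/
theorem sum_mul_sum_le_of_antitone {D : α → ℝ} (hD0 : ∀ a, 0 ≤ D a) (hD : ∑ a, D a = 1)
    (r : α → ℕ) {f g : α → ℝ} (hf : ∀ a b, r a ≤ r b → f b ≤ f a)
    (hg : ∀ a b, r a ≤ r b → g b ≤ g a) :
    (∑ a, D a * f a) * (∑ a, D a * g a) ≤ ∑ a, D a * (f a * g a) := by
  -- Compare two independent copies: `f` and `g` always differ in the same direction.
  have hpos : 0 ≤ ∑ a, ∑ b, D a * D b * ((f a - f b) * (g a - g b)) := by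
    refine Finset.sum_nonneg fun a _ => Finset.sum_nonneg fun b _ =>
      mul_nonneg (mul_nonneg (hD0 a) (hD0 b)) ?_
    rcases le_total (r a) (r b) with h | h
    · exact mul_nonneg (sub_nonneg.2 (hf _ _ h)) (sub_nonneg.2 (hg _ _ h))
    · exact mul_nonneg_of_nonpos_of_nonpos (sub_nonpos.2 (hf _ _ h)) (sub_nonpos.2 (hg _ _ h))
  have hexp : ∑ a, ∑ b, D a * D b * ((f a - f b) * (g a - g b))
      = 2 * ((∑ a, D a) * ∑ a, D a * (f a * g a))
        - 2 * ((∑ a, D a * f a) * (∑ a, D a * g a)) := by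
    have e1 : ∀ a b, D a * D b * ((f a - f b) * (g a - g b))
        = (D a * (f a * g a)) * D b + D a * (D b * (f b * g b))
          - (D a * f a) * (D b * g b) - (D a * g a) * (D b * f b) := fun a b => by ring
    simp only [e1, Finset.sum_sub_distrib, Finset.sum_add_distrib]
    rw [← Finset.sum_mul_sum, ← Finset.sum_mul_sum, ← Finset.sum_mul_sum, ← Finset.sum_mul_sum]
    ring
  rw [hexp, hD] at hpos
  linarith

/-- Harris' inequality: functions that are nonincreasing in every coordinate are positively
correlated. -/
theorem prodExpect_mul_le_of_antitone {D : ι → α → ℝ} (hD0 : ∀ i a, 0 ≤ D i a)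
    (hD : ∀ i, ∑ a, D i a = 1) (r : α → ℕ) {f g : (ι → α) → ℝ}
    (hf : ∀ T T', (∀ i, r (T i) ≤ r (T' i)) → f T' ≤ f T)
    (hg : ∀ T T', (∀ i, r (T i) ≤ r (T' i)) → g T' ≤ g T) :
    prodExpect D f * prodExpect D g ≤ prodExpect D (fun T => f T * g T) := by
  -- Induct on the set of coordinates on which `f` and `g` depend. Averaging over one of them keeps
  -- monotonicity, and the one-dimensional inequality handles that average.
  have main : ∀ s : Finset ι, ∀ f g : (ι → α) → ℝ,
      (∀ T T', (∀ i, r (T i) ≤ r (T' i)) → f T' ≤ f T) →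
      (∀ T T', (∀ i, r (T i) ≤ r (T' i)) → g T' ≤ g T) →
      (∀ T T', (∀ i ∈ s, T i = T' i) → f T = f T') →
      (∀ T T', (∀ i ∈ s, T i = T' i) → g T = g T') →
      prodExpect D f * prodExpect D g ≤ prodExpect D (fun T => f T * g T) := by
    intro s
    induction s using Finset.induction_on with
    | empty =>
      intro f g _ _ hfs hgs
      rcases isEmpty_or_nonempty (ι → α) with hE | ⟨⟨T0⟩⟩
      · simp [prodExpect]
      · have e1 : f = fun _ => f T0 := funext fun T => hfs _ _ (by simp)
        have e2 : g = fun _ => g T0 := funext fun T => hgs _ _ (by simp)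
        rw [e1, e2, prodExpect_const hD, prodExpect_const hD, prodExpect_const hD]
    | insert l s hl ih =>
      intro f g hf hg hfs hgs
      have hupd : ∀ (T T' : ι → α) (a b : α), (∀ i, r (T i) ≤ r (T' i)) → r a ≤ r b →
          ∀ i, r (Function.update T l a i) ≤ r (Function.update T' l b i) := by
        intro T T' a b hT hab i
        rcases eq_or_ne i l with rfl | hi
        · simpa using hab
        · simpa [Function.update_of_ne hi] using hT i
      have havg : ∀ f : (ι → α) → ℝ, (∀ T T', (∀ i, r (T i) ≤ r (T' i)) → f T' ≤ f T) →
          ∀ T T', (∀ i, r (T i) ≤ r (T' i)) → coordAverage D l f T' ≤ coordAverage D l f T :=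
        fun f hf T T' hT => Finset.sum_le_sum fun a _ =>
          mul_le_mul_of_nonneg_left (hf _ _ (hupd T T' a a hT le_rfl)) (hD0 l a)
      have hdep : ∀ f : (ι → α) → ℝ, (∀ T T', (∀ i ∈ insert l s, T i = T' i) → f T = f T') →
          ∀ T T', (∀ i ∈ s, T i = T' i) → coordAverage D l f T = coordAverage D l f T' := by
        intro f hfs T T' hT
        refine Finset.sum_congr rfl fun a _ => ?_
        rw [hfs (Function.update T l a) (Function.update T' l a)]
        intro i hi
        rcases eq_or_ne i l with rfl | hil
        · simp
        · simpa [Function.update_of_ne hil] using hT i (Finset.mem_of_mem_insert_of_ne hi hil)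
      have h := ih _ _ (havg f hf) (havg g hg) (hdep f hfs) (hdep g hgs)
      rw [prodExpect_coordAverage l (hD l), prodExpect_coordAverage l (hD l)] at h
      refine h.trans ?_
      rw [← prodExpect_coordAverage l (hD l) (fun T => f T * g T)]
      exact prodExpect_mono hD0 fun T =>
        sum_mul_sum_le_of_antitone (hD0 l) (hD l) r
          (fun a b hab => hf _ _ (hupd T T a b (fun _ => le_rfl) hab))
          (fun a b hab => hg _ _ (hupd T T a b (fun _ => le_rfl) hab))
  exact main Finset.univ f g hf hg
    (fun T T' h => congrArg f (funext fun i => h i (Finset.mem_univ i)))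
    (fun T T' h => congrArg g (funext fun i => h i (Finset.mem_univ i)))

end ProductExpectation

/-! ### Quadratic minorants and deterministic sum inequalities. -/

section RealInequalities

/-- A concave quadratic minorant of `x ↦ min 1 (m / (1 + x))`, evaluated at the moments of a sum
of independent indicators with mean `μ ≤ m`. -/
theorem exists_quadratic_le_min_one_div (m : ℕ) (hm : 0 < m) {μ : ℝ}
    (hμ : μ ≤ m) :
    ∃ c₀ c₁ c₂ : ℝ, c₂ ≤ 0 ∧
      (∀ x : ℝ, 0 ≤ x → c₀ + c₁ * x + c₂ * x ^ 2 ≤ min 1 ((m : ℝ) / (1 + x))) ∧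
      1 - 1 / Real.sqrt ((m : ℝ) + 3) ≤ c₀ + c₁ * μ + c₂ * (μ ^ 2 + μ) := by
  rcases Nat.lt_or_ge m 2 with h1 | h2
  · obtain rfl : m = 1 := by omega
    have h4 : Real.sqrt (((1 : ℕ) : ℝ) + 3) = 2 := by
      rw [show (((1 : ℕ) : ℝ) + 3) = 2 ^ 2 by norm_num]
      exact Real.sqrt_sq (by norm_num)
    -- The tangent of `1 / (1 + x)` at `x = 1` already suffices.
    refine ⟨3 / 4, -1 / 4, 0, le_rfl, fun x hx => ?_, ?_⟩
    · refine le_min (by linarith) ?_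
      rw [Nat.cast_one, le_div_iff₀ (by linarith)]
      nlinarith [sq_nonneg (x - 1)]
    · rw [h4]
      push_cast at hμ
      linarith
  · have hm2 : (2 : ℝ) ≤ m := by exact_mod_cast h2
    set w := Real.sqrt ((m : ℝ) + 1) with hw
    have hww : w ^ 2 = m + 1 := Real.sq_sqrt (by linarith)
    have hw17 : (17 : ℝ) / 10 ≤ w := Real.le_sqrt_of_sq_le (by linarith)
    have hmw : (m : ℝ) = (w - 1) * (w + 1) := by linarith [hww]
    have hm0 : (0 : ℝ) < m := by linarith
    -- `a` bounds the mean of `1 + U / m` below; the choice `w = √(m + 1)` minimizes this bound at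
    -- `μ = m`.
    set a : ℝ := 1 + (w + 1) / (2 * m) with ha
    have ha1 : 1 ≤ a := by
      have : 0 ≤ (w + 1) / (2 * m) := by positivity
      linarith
    have ha0 : 0 < a := by linarith
    have hainv : 1 / a = 1 - 1 / (2 * w - 1) := by
      have h1 : w - 1 ≠ 0 := by linarith
      have h2 : w + 1 ≠ 0 := by linarith
      have h3 : 2 * w - 1 ≠ 0 := by linarith
      have : a = (2 * w - 1) / (2 * (w - 1)) := by
        rw [ha, hmw]
        field_simp
        ring
      rw [this]
      field_simp
      ring
    have hfin : 1 - 1 / Real.sqrt ((m : ℝ) + 3) ≤ 1 / a := by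
      rw [hainv]
      -- This inequality fails at `m = 1`, hence the separate case.
      have : Real.sqrt ((m : ℝ) + 3) ≤ 2 * w - 1 :=
        Real.sqrt_le_iff.2 ⟨by linarith, by nlinarith⟩
      have hpos : 0 < Real.sqrt ((m : ℝ) + 3) := Real.sqrt_pos.2 (by linarith)
      linarith [one_div_le_one_div_of_le hpos this]
    -- For real `y`, `(y + w) ^ 2 / (4 * w)` is at least `max y 0`. With `y = x - μ + 1` and `μ ≤
    -- m`, this bounds `max 1 ((1 + x) / m)` by `1 + U x / m`.
    set U : ℝ → ℝ := fun x => (x - μ + 1) ^ 2 / (4 * w) + w / 4 + (x - μ + 1) / 2 with hU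
    have hw0 : 0 < w := by linarith
    have hUsq : ∀ x, U x = (x - μ + 1 + w) ^ 2 / (4 * w) := by
      intro x
      simp only [hU]
      field_simp
      ring
    have hU0 : ∀ x, 0 ≤ U x := fun x => by rw [hUsq]; positivity
    have hUx : ∀ x, x - μ + 1 ≤ U x := by
      intro x
      rw [hUsq, le_div_iff₀ (by positivity)]
      nlinarith [sq_nonneg (x - μ + 1 - w)]
    refine ⟨2 / a - 1 / a ^ 2 - ((1 - μ) ^ 2 / (4 * w) + w / 4 + (1 - μ) / 2) / (m * a ^ 2),
      -((1 - μ) / (2 * w) + 1 / 2) / (m * a ^ 2), -(1 / (4 * w)) / (m * a ^ 2), ?_, ?_, ?_⟩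
    · rw [neg_div]
      exact neg_nonpos.2 (by positivity)
    · intro x hx
      have e : 2 / a - 1 / a ^ 2 - ((1 - μ) ^ 2 / (4 * w) + w / 4 + (1 - μ) / 2) / (m * a ^ 2)
          + -((1 - μ) / (2 * w) + 1 / 2) / (m * a ^ 2) * x
          + -(1 / (4 * w)) / (m * a ^ 2) * x ^ 2
          = 2 / a - (1 + U x / m) / a ^ 2 := by
        simp only [hU]
        field_simp
        ring
      rw [e]
      -- Minorize `1 / y` by its tangent at `a`, which turns the upper bound by `U` into a concave
      -- quadratic.
      have key : ∀ y : ℝ, 0 < y → y ≤ 1 + U x / m →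
          2 / a - (1 + U x / m) / a ^ 2 ≤ 1 / y := by
        intro y hy hyU
        have h1 : 2 / a - y / a ^ 2 ≤ 1 / y := by
          have : 1 / y - (2 / a - y / a ^ 2) = (a - y) ^ 2 / (y * a ^ 2) := by
            field_simp
            ring
          have h2 : 0 ≤ (a - y) ^ 2 / (y * a ^ 2) := by positivity
          linarith
        have h2 : y / a ^ 2 ≤ (1 + U x / m) / a ^ 2 :=
          div_le_div_of_nonneg_right hyU (by positivity)
        linarith
      refine le_min ?_ ?_
      · have := key 1 one_pos (by
          have : 0 ≤ U x / m := div_nonneg (hU0 x) hm0.le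
          linarith)
        simpa using this
      · have := key ((1 + x) / m) (by positivity) (by
          rw [← sub_nonneg]
          have e2 : 1 + U x / m - (1 + x) / m = (m + U x - (1 + x)) / m := by
            field_simp
          rw [e2]
          exact div_nonneg (by linarith [hUx x]) hm0.le)
        rwa [one_div_div] at this
    · refine hfin.trans ?_
      have e : 2 / a - 1 / a ^ 2 - ((1 - μ) ^ 2 / (4 * w) + w / 4 + (1 - μ) / 2) / (m * a ^ 2)
          + -((1 - μ) / (2 * w) + 1 / 2) / (m * a ^ 2) * μ
          + -(1 / (4 * w)) / (m * a ^ 2) * (μ ^ 2 + μ)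
          = 2 / a - (1 + ((μ + 1) / (4 * w) + w / 4 + 1 / 2) / m) / a ^ 2 := by
        field_simp
        ring
      rw [e]
      have h1 : (μ + 1) / (4 * w) ≤ w / 4 := by
        rw [div_le_iff₀ (by positivity)]
        nlinarith
      have h2 : 1 + ((μ + 1) / (4 * w) + w / 4 + 1 / 2) / m ≤ a := by
        have : ((μ + 1) / (4 * w) + w / 4 + 1 / 2) / m ≤ ((w + 1) / 2) / m :=
          div_le_div_of_nonneg_right (by linarith) hm0.le
        rw [div_div] at this
        linarith
      have h3 : (1 + ((μ + 1) / (4 * w) + w / 4 + 1 / 2) / m) / a ^ 2 ≤ a / a ^ 2 :=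
        div_le_div_of_nonneg_right h2 (by positivity)
      have h4 : a / a ^ 2 = 1 / a := by field_simp
      have h5 : 2 / a = 1 / a + 1 / a := by ring
      linarith

/-- A concave quadratic minorant of `x ↦ min x (k - 1)`, evaluated at the moments of a sum
of independent `[0,1]`-valued variables with mean `μ ≤ k`. -/
theorem exists_quadratic_le_min_sub_one {k μ : ℝ} (hk : 1 ≤ k) (hμ0 : 0 ≤ μ) (hμ : μ ≤ k) :
    ∃ c₀ c₁ c₂ : ℝ, c₂ ≤ 0 ∧
      (∀ x : ℝ, 0 ≤ x → c₀ + c₁ * x + c₂ * x ^ 2 ≤ min x (k - 1)) ∧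
      ((k - 1) / k * (1 - 1 / Real.sqrt k)) * μ ≤ c₀ + c₁ * μ + c₂ * (μ ^ 2 + μ) := by
  have hk0 : 0 < k := by linarith
  set t := Real.sqrt k with ht
  have htt : t ^ 2 = k := Real.sq_sqrt hk0.le
  have ht1 : 1 ≤ t := Real.one_le_sqrt.2 hk
  have ht0 : 0 < t := by linarith
  rcases hμ0.eq_or_lt with rfl | hμpos
  · exact ⟨0, 0, 0, le_rfl, fun x hx => by simpa using ⟨hx, hk⟩, by simp⟩
  rcases le_total k 4 with h4 | h4
  · have ht2 : t ≤ 2 := Real.sqrt_le_iff.2 ⟨by norm_num, by linarith⟩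
    -- For small `k`, take the parabola through the origin that touches the level `k - 1` at its
    -- vertex `x = 2 * k`.
    refine ⟨0, (k - 1) / k, -((k - 1) / (4 * k ^ 2)), ?_, ?_, ?_⟩
    · exact neg_nonpos.2 (div_nonneg (by linarith) (by positivity))
    · intro x hx
      have hq : 0 ≤ (k - 1) / (4 * k ^ 2) := div_nonneg (by linarith) (by positivity)
      refine le_min ?_ ?_
      · have h1 : (k - 1) / k ≤ 1 := (div_le_one hk0).2 (by linarith)
        nlinarith [mul_nonneg hq (sq_nonneg x)]
      · have e : k - 1 - (0 + (k - 1) / k * x + -((k - 1) / (4 * k ^ 2)) * x ^ 2)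
            = (k - 1) / (4 * k ^ 2) * (x - 2 * k) ^ 2 := by
          field_simp
          ring
        linarith [mul_nonneg hq (sq_nonneg (x - 2 * k))]
    · have e : 0 + (k - 1) / k * μ + -((k - 1) / (4 * k ^ 2)) * (μ ^ 2 + μ)
          = ((k - 1) / k * (1 - (μ + 1) / (4 * k))) * μ := by
        field_simp
        ring
      rw [e]
      refine mul_le_mul_of_nonneg_right (mul_le_mul_of_nonneg_left ?_
        (div_nonneg (by linarith) hk0.le)) hμ0
      have : (μ + 1) / (4 * k) ≤ 1 / t := by
        rw [div_le_div_iff₀ (by positivity) ht0]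
        nlinarith
      linarith
  · have ht2 : 2 ≤ t := Real.le_sqrt_of_sq_le (by linarith)
    set n := k - 1 with hn
    -- `1 - κ` is exactly the claimed factor, so a loss of `κ * μ` is allowed.
    set κ := (1 + n / t) / k with hκ
    have hκt : κ * t ^ 3 = t ^ 2 + t - 1 := by
      rw [hκ, hn, ← htt]
      field_simp
      ring
    have hκ0 : 0 < κ := by
      have : 0 ≤ n / t := div_nonneg (by linarith) ht0.le
      positivity
    have hκ1 : κ ≤ 1 := by
      have : κ * t ^ 3 ≤ 1 * t ^ 3 := by
        nlinarith [mul_nonneg (sq_nonneg (t - 1)) (by linarith : (0 : ℝ) ≤ t + 1)]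
      exact le_of_mul_le_mul_right this (by positivity)
    have hy : 1 ≤ κ * t := by
      have : 1 * t ^ 2 ≤ (κ * t) * t ^ 2 := by nlinarith
      exact le_of_mul_le_mul_right this (by positivity)
    set e := μ - n with he
    have he1 : e ≤ 1 := by linarith
    -- This is the required moment inequality at the optimal `s`, divided by `μ`. As `κ ≤ 1`, its
    -- worst case is `e = 1`, that is `μ = k`.
    have hmain : 1 + 4 * κ * e ≤ 4 * μ * κ ^ 2 := by
      have h1 : 4 * κ * (1 - κ) * e ≤ 4 * κ * (1 - κ) * 1 :=
        mul_le_mul_of_nonneg_left he1 (by nlinarith)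
      have h2 : 4 * κ + 1 ≤ 4 * κ ^ 2 * k := by
        rw [← htt]
        nlinarith
      have h3 : μ = k - 1 + e := by rw [he, hn]; ring
      rw [h3]
      nlinarith
    -- The minorant is `x - (x - n + s) ^ 2 / (4 * s)`, touching both `x` and `n`. This `s`
    -- minimizes `(e + s) ^ 2 - 4 * s * κ * μ`.
    set s := 2 * μ * κ - e with hs
    have hs0 : 0 < s := by
      rcases le_total e 0 with h | h
      · have : 0 < 2 * μ * κ := by positivity
        linarith
      · have : κ * e < κ * (μ * κ) := by nlinarith
        have := lt_of_mul_lt_mul_left this hκ0.le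
        nlinarith
    refine ⟨-((s - n) ^ 2 / (4 * s)), 1 - (s - n) / (2 * s), -(1 / (4 * s)), ?_, ?_, ?_⟩
    · exact neg_nonpos.2 (by positivity)
    · intro x hx
      have e1 : -((s - n) ^ 2 / (4 * s)) + (1 - (s - n) / (2 * s)) * x + -(1 / (4 * s)) * x ^ 2
          = x - (x - n + s) ^ 2 / (4 * s) := by
        field_simp
        ring
      have e2 : x - (x - n + s) ^ 2 / (4 * s) = n - (x - n - s) ^ 2 / (4 * s) := by
        field_simp
        ring
      rw [e1]
      have p1 : 0 ≤ (x - n + s) ^ 2 / (4 * s) := by positivity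
      have p2 : 0 ≤ (x - n - s) ^ 2 / (4 * s) := by positivity
      exact le_min (by linarith) (by linarith)
    · have e1 : -((s - n) ^ 2 / (4 * s)) + (1 - (s - n) / (2 * s)) * μ
            + -(1 / (4 * s)) * (μ ^ 2 + μ) = μ - (μ + (μ - n + s) ^ 2) / (4 * s) := by
        field_simp
        ring
      have e2 : μ - n + s = 2 * μ * κ := by rw [hs, he]; ring
      have e3 : n / k * (1 - 1 / t) = 1 - κ := by
        rw [hκ, hn]
        field_simp
        ring
      rw [e1, e2, e3]
      have : (μ + (2 * μ * κ) ^ 2) / (4 * s) ≤ κ * μ := by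
        rw [div_le_iff₀ (by positivity), hs]
        nlinarith
      linarith

/-- If `a / b` and `g` are nonincreasing, then the mean of `g` with weights `a` is at least its
mean with weights `b`. -/
theorem sum_mul_sum_le_sum_mul_sum {ι : Type*} [Fintype ι] [LinearOrder ι] {a b g : ι → ℝ}
    (hab : ∀ i j, i < j → a j * b i ≤ a i * b j) (hg : ∀ i j, i ≤ j → g j ≤ g i) :
    (∑ i, a i) * (∑ i, b i * g i) ≤ (∑ i, a i * g i) * (∑ i, b i) := by
  have hpos : 0 ≤ ∑ i, ∑ j, (a i * b j - a j * b i) * (g i - g j) := by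
    refine Finset.sum_nonneg fun i _ => Finset.sum_nonneg fun j _ => ?_
    rcases lt_trichotomy i j with h | rfl | h
    · exact mul_nonneg (sub_nonneg.2 (hab i j h)) (sub_nonneg.2 (hg i j h.le))
    · simp
    · exact mul_nonneg_of_nonpos_of_nonpos (sub_nonpos.2 (hab j i h))
        (sub_nonpos.2 (hg j i h.le))
  have hexp : ∑ i, ∑ j, (a i * b j - a j * b i) * (g i - g j)
      = 2 * ((∑ i, a i * g i) * (∑ i, b i)) - 2 * ((∑ i, a i) * (∑ i, b i * g i)) := by
    have e1 : ∀ i j, (a i * b j - a j * b i) * (g i - g j)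
        = (a i * g i) * b j - a i * (b j * g j) - (b i * g i) * a j + b i * (a j * g j) :=
      fun i j => by ring
    simp only [e1, Finset.sum_sub_distrib, Finset.sum_add_distrib]
    rw [← Finset.sum_mul_sum, ← Finset.sum_mul_sum, ← Finset.sum_mul_sum, ← Finset.sum_mul_sum]
    ring
  rw [hexp] at hpos
  linarith

/-- The terms that are added while the preceding partial sum is at most `n` sum up to at least
the minimum of `n` and the total. -/
theorem min_sum_le_sum_mul_prefix {L : ℕ} (d : Fin L → ℝ) (hd : ∀ i, 0 ≤ d i) (n : ℝ) :
    min (∑ i, d i) n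
      ≤ ∑ i, d i * (if (∑ j, if j < i then d j else 0) ≤ n then (1 : ℝ) else 0) := by
  induction L with
  | zero => simp
  | succ L ih =>
    have h := ih (fun i => d i.castSucc) (fun i => hd _)
    simp only [Fin.sum_univ_castSucc, Fin.castSucc_lt_castSucc_iff, Fin.castSucc_lt_last,
      Fin.not_lt.2 (Fin.le_last _), if_true, if_false, add_zero] at h ⊢
    have hl := hd (Fin.last L)
    -- Either the last term is counted as well, or the preceding terms already exceed `n`.
    split_ifs with hc
    · rw [min_eq_left hc] at h
      exact (min_le_left _ _).trans (by linarith)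
    · rw [min_eq_right (not_le.1 hc).le] at h
      exact (min_le_right _ _).trans (by linarith)

/-- The average over a part of a finite set with the highest values is at least the average
over the whole set. -/
theorem card_mul_sum_le_card_mul_sum {ι : Type*} [DecidableEq ι] {R S : Finset ι} (hRS : R ⊆ S)
    {v : ι → ℝ} (h : ∀ i ∈ R, ∀ j ∈ S \ R, v j ≤ v i) :
    (R.card : ℝ) * ∑ i ∈ S, v i ≤ S.card * ∑ i ∈ R, v i := by
  have h1 : ∑ i ∈ R, ∑ j ∈ S \ R, v j ≤ ∑ i ∈ R, ∑ j ∈ S \ R, v i :=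
    Finset.sum_le_sum fun i hi => Finset.sum_le_sum fun j hj => h i hi j hj
  simp only [Finset.sum_const, nsmul_eq_mul, ← Finset.mul_sum] at h1
  have h2 : ((S \ R).card : ℝ) + R.card = S.card := by
    exact_mod_cast Finset.card_sdiff_add_card_eq_card hRS
  rw [← Finset.sum_sdiff hRS, ← h2]
  linarith

end RealInequalities

/-! ### Moment bounds for contention and for the greedy prefix. -/

section ProductExpectation

variable {ι α : Type*} [Fintype ι] [DecidableEq ι] [Fintype α]

theorem prodExpect_sum_apply {D : ι → α → ℝ} (hD : ∀ i, ∑ a, D i a = 1) (s : Finset ι)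
    (h : ι → α → ℝ) :
    prodExpect D (fun T => ∑ i ∈ s, h i (T i)) = ∑ i ∈ s, ∑ a, D i a * h i a := by
  rw [prodExpect_sum]
  exact Finset.sum_congr rfl fun i _ => prodExpect_apply hD i (h i)

/-- A concave quadratic minorant bounds the expectation of a function of a sum of independent
`[0,1]`-valued variables from below. -/
theorem le_prodExpect_of_quadratic_le {D : ι → α → ℝ} (hD0 : ∀ i a, 0 ≤ D i a)
    (hD : ∀ i, ∑ a, D i a = 1) (s : Finset ι) (h : ι → α → ℝ) (h0 : ∀ i a, 0 ≤ h i a)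
    (h1 : ∀ i a, h i a ≤ 1) {c₀ c₁ c₂ : ℝ} (hc : c₂ ≤ 0) {F : ℝ → ℝ}
    (hF : ∀ x, 0 ≤ x → c₀ + c₁ * x + c₂ * x ^ 2 ≤ F x) {μ : ℝ}
    (hμ : ∑ i ∈ s, ∑ a, D i a * h i a = μ) :
    c₀ + c₁ * μ + c₂ * (μ ^ 2 + μ) ≤ prodExpect D (fun T => F (∑ i ∈ s, h i (T i))) := by
  have hsq := prodExpect_sq_sum_le hD0 hD s h h0 h1
  rw [hμ] at hsq
  -- Since `c₂ ≤ 0`, an upper bound on the second moment suffices.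
  calc c₀ + c₁ * μ + c₂ * (μ ^ 2 + μ)
      ≤ c₀ + c₁ * μ + c₂ * prodExpect D (fun T => (∑ i ∈ s, h i (T i)) ^ 2) := by
        linarith [mul_le_mul_of_nonpos_left hsq hc]
    _ = prodExpect D (fun T => c₀ + c₁ * (∑ i ∈ s, h i (T i))
          + c₂ * (∑ i ∈ s, h i (T i)) ^ 2) := by
        rw [prodExpect_add, prodExpect_add, prodExpect_const hD, prodExpect_const_mul,
          prodExpect_const_mul, prodExpect_sum_apply hD, hμ]
    _ ≤ _ := prodExpect_mono hD0 fun T => hF _ (Finset.sum_nonneg fun i _ => h0 i _)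

/-- An item that competes with independent items of mean number at most `m` for `m` places, given
out uniformly at random, gets a place with probability at least `1 - 1 / √(m + 3)`. -/
theorem le_prodExpect_min_one_div {D : ι → α → ℝ} (hD0 : ∀ i a, 0 ≤ D i a)
    (hD : ∀ i, ∑ a, D i a = 1) (s : Finset ι) (h : ι → α → ℝ) (h0 : ∀ i a, 0 ≤ h i a)
    (h1 : ∀ i a, h i a ≤ 1) {m : ℕ} (hm : 0 < m)
    (hmean : ∑ i ∈ s, ∑ a, D i a * h i a ≤ m) :
    1 - 1 / Real.sqrt ((m : ℝ) + 3)
      ≤ prodExpect D (fun T => min 1 ((m : ℝ) / (1 + ∑ i ∈ s, h i (T i)))) := by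
  obtain ⟨c₀, c₁, c₂, hc, hF, hval⟩ := exists_quadratic_le_min_one_div m hm hmean
  exact hval.trans (le_prodExpect_of_quadratic_le hD0 hD s h h0 h1 hc
    (F := fun x => min 1 ((m : ℝ) / (1 + x))) hF rfl)

/-- Items of random sizes in `[0,1]` and of total mean at most `k` arrive in an order of
nonincreasing ratio of value `a` to mean size. The expected value of the items which arrive
while the total size is at most `k - 1` is at least a fraction
`((k - 1) / k) * (1 - 1 / √k)` of the total value. -/
theorem le_sum_mul_prodExpect_prefix {L : ℕ} {D : Fin L → α → ℝ} (hD0 : ∀ i a, 0 ≤ D i a)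
    (hD : ∀ i, ∑ a, D i a = 1) (h : Fin L → α → ℝ) (h0 : ∀ i a, 0 ≤ h i a)
    (h1 : ∀ i a, h i a ≤ 1) (σ : Equiv.Perm (Fin L)) {k : ℝ} (hk : 1 ≤ k)
    (hmean : ∑ l, ∑ x, D l x * h l x ≤ k) {a : Fin L → ℝ} (ha : ∀ l, 0 ≤ a l)
    (hab : ∀ i j, i < j → a (σ j) * ∑ x, D (σ i) x * h (σ i) x
      ≤ a (σ i) * ∑ x, D (σ j) x * h (σ j) x) :
    (k - 1) / k * (1 - 1 / Real.sqrt k) * ∑ l, a l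
      ≤ ∑ i, a (σ i) * prodExpect D (fun T =>
          if (∑ j, if j < i then h (σ j) (T (σ j)) else 0) ≤ k - 1 then 1 else 0) := by
  set β := (k - 1) / k * (1 - 1 / Real.sqrt k) with hβ
  have hβ1 : β ≤ 1 := by
    have h2 : (k - 1) / k ≤ 1 := (div_le_one (by linarith)).2 (by linarith)
    have h3 : 0 ≤ 1 / Real.sqrt k := by positivity
    have h4 : 0 ≤ (k - 1) / k := div_nonneg (by linarith) (by linarith)
    nlinarith
  set b : Fin L → ℝ := fun l => ∑ x, D l x * h l x with hb
  have hb0 : ∀ l, 0 ≤ b l := fun l =>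
    Finset.sum_nonneg fun x _ => mul_nonneg (hD0 l x) (h0 l x)
  set W : (Fin L → α) → Fin L → ℝ := fun T i => ∑ j, if j < i then h (σ j) (T (σ j)) else 0
    with hW
  set g : Fin L → ℝ := fun i => prodExpect D (fun T => if W T i ≤ k - 1 then 1 else 0) with hg
  have hsum : ∀ f : Fin L → ℝ, ∑ l, f l = ∑ i, f (σ i) := fun f => (Equiv.sum_comp σ f).symm
  change β * ∑ l, a l ≤ ∑ i, a (σ i) * g i
  -- If the total mean size is zero, one cannot cancel it, but then almost surely every prefix is
  -- zero and every item arrives in time.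
  rcases (Finset.sum_nonneg fun l (_ : l ∈ Finset.univ) => hb0 l).eq_or_lt with hμ | hμ
  · have hbz : ∀ l, b l = 0 := fun l =>
      (Finset.sum_eq_zero_iff_of_nonneg fun l _ => hb0 l).1 hμ.symm l (Finset.mem_univ l)
    have hDh : ∀ l x, D l x ≠ 0 → h l x = 0 := fun l x hx =>
      (mul_eq_zero.1 ((Finset.sum_eq_zero_iff_of_nonneg fun x _ =>
        mul_nonneg (hD0 l x) (h0 l x)).1 (hbz l) x (Finset.mem_univ x))).resolve_left hx
    have hg1 : ∀ i, 1 ≤ g i := by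
      intro i
      rw [← prodExpect_const hD 1]
      refine prodExpect_mono_of_support hD0 fun T hT => ?_
      have : W T i = 0 := Finset.sum_eq_zero fun j _ => by
        rw [hDh _ _ (hT (σ j)), ite_self]
      rw [this, if_pos (by linarith)]
    rw [hsum, Finset.mul_sum]
    refine Finset.sum_le_sum fun i _ => ?_
    rw [mul_comm]
    exact mul_le_mul_of_nonneg_left (hβ1.trans (hg1 i)) (ha _)
  · have hmono : ∀ i j, i ≤ j → g j ≤ g i := by
      intro i j hij
      refine prodExpect_mono hD0 fun T => ?_
      have hWij : W T i ≤ W T j := Finset.sum_le_sum fun m _ => by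
        split_ifs with h3 h4
        · exact le_rfl
        · exact absurd (h3.trans_le hij) h4
        · exact h0 _ _
        · exact le_rfl
      split_ifs with h3 h4
      · exact le_rfl
      · exact absurd (hWij.trans h3) h4
      · exact zero_le_one
      · exact le_rfl
    have hcheb := sum_mul_sum_le_sum_mul_sum (a := fun i => a (σ i)) (b := fun i => b (σ i))
      hab hmono
    -- The size of item `i` is independent of the prefix strictly before it.
    have hbg : ∑ i, b (σ i) * g i
        = prodExpect D (fun T => ∑ i, h (σ i) (T (σ i)) * if W T i ≤ k - 1 then 1 else 0) := by
      rw [prodExpect_sum]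
      refine Finset.sum_congr rfl fun i _ => ?_
      refine (prodExpect_apply_mul (σ i) (hD _) (h (σ i))
        (fun T => if W T i ≤ k - 1 then 1 else 0) fun T x => ?_).symm
      have : W (Function.update T (σ i) x) i = W T i := Finset.sum_congr rfl fun j _ => by
        split_ifs with hj
        · rw [Function.update_of_ne (σ.injective.ne hj.ne)]
        · rfl
      simp only [this]
    obtain ⟨c₀, c₁, c₂, hc, hF, hval⟩ :=
      exists_quadratic_le_min_sub_one hk hμ.le hmean
    have hmin : β * ∑ l, b l ≤ ∑ i, b (σ i) * g i := by
      refine hval.trans ((le_prodExpect_of_quadratic_le hD0 hD Finset.univ h h0 h1 hc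
        (F := fun x => min x (k - 1)) hF rfl).trans ?_)
      rw [hbg]
      refine prodExpect_mono hD0 fun T => ?_
      rw [hsum]
      exact min_sum_le_sum_mul_prefix (fun i => h (σ i) (T (σ i))) (fun i => h0 _ _) (k - 1)
    refine le_of_mul_le_mul_right ?_ hμ
    rw [← hsum, ← hsum] at hcheb
    calc β * (∑ l, a l) * ∑ l, b l = (∑ l, a l) * (β * ∑ l, b l) := by ring
      _ ≤ (∑ l, a l) * ∑ i, b (σ i) * g i :=
        mul_le_mul_of_nonneg_left hmin (Finset.sum_nonneg fun l _ => ha l)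
      _ ≤ _ := hcheb

end ProductExpectation

/-! ### Trimming an assignment. -/

variable {L P : ℕ}

/-- Trimming the assignment `G` retains, for the item `p`, at least the fraction `m / N` of the
reward, where `N` is any upper bound for the number of bins of `p`. -/
theorem Inst.Trim.min_mul_sum_le {I : Inst L P} {G A : Assignment L P} (h : I.Trim G A)
    (p : Fin P) {N : ℕ} (hN : (binsOf G p).card ≤ N) :
    min 1 ((I.mult p : ℝ) / N) * ∑ l ∈ binsOf G p, I.reward l p
      ≤ ∑ l ∈ binsOf A p, I.reward l p := by
  have hAvg := card_mul_sum_le_card_mul_sum (h.subset p) (v := fun l => I.reward l p)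
    (h.highest p)
  have hG0 : 0 ≤ ∑ l ∈ binsOf G p, I.reward l p :=
    Finset.sum_nonneg fun l _ => I.reward_nonneg l p
  rcases Nat.eq_zero_or_pos (binsOf G p).card with h0 | hpos
  · rw [Finset.card_eq_zero.1 h0, Finset.sum_empty, mul_zero]
    exact Finset.sum_nonneg fun l _ => I.reward_nonneg l p
  · have hpos' : (0 : ℝ) < (binsOf G p).card := by exact_mod_cast hpos
    have hNG : ((binsOf G p).card : ℝ) ≤ N := by exact_mod_cast hN
    refine le_of_mul_le_mul_left (le_trans ?_ hAvg) hpos'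
    rw [← mul_assoc]
    refine mul_le_mul_of_nonneg_right ?_ hG0
    rw [h.card_eq p, Nat.cast_min, min_comm]
    refine le_min ?_ ?_
    · calc ((binsOf G p).card : ℝ) * min ((I.mult p : ℝ) / N) 1
          ≤ (binsOf G p).card * ((I.mult p : ℝ) / (binsOf G p).card) := by
            refine mul_le_mul_of_nonneg_left ((min_le_left _ _).trans ?_) hpos'.le
            exact div_le_div_of_nonneg_left (Nat.cast_nonneg _) hpos' hNG
        _ = I.mult p := by field_simp
    · calc ((binsOf G p).card : ℝ) * min ((I.mult p : ℝ) / N) 1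
          ≤ (binsOf G p).card * 1 := mul_le_mul_of_nonneg_left (min_le_right _ _) hpos'.le
        _ = _ := mul_one _

theorem Inst.value_eq_sum_binsOf (I : Inst L P) (A : Assignment L P) :
    I.value A = ∑ p, ∑ l ∈ binsOf A p, I.reward l p := by
  simp only [Inst.value, binsOf, Finset.sum_filter]
  rw [Finset.sum_comm]
  refine Finset.sum_congr rfl fun l _ => ?_
  rw [← Finset.sum_filter]
  exact Finset.sum_congr (by simp) fun _ _ => rfl

/-! ### Costs normalized by the largest configuration cost. -/

namespace Inst

variable (I : Inst L P)

/-- The largest cost of a configuration. -/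
noncomputable def maxCost : ℝ := sSup {c : ℝ | ∃ l, ∃ S ∈ I.configs l, c = I.configCost l S}

/-- The cost of bin `l`, if it gets a nonempty set, in units of the largest cost of a
configuration. -/
noncomputable def unitCost (l : Fin L) (S : Finset (Fin P)) : ℝ :=
  -- A bin without configurations may cost more than `maxCost`; the truncation keeps all values in
  -- `[0,1]`.
  if S.Nonempty then min (I.binCost l) I.maxCost / I.maxCost else 0

variable {I}

theorem nonempty_of_mem_configs {l : Fin L} {S : Finset (Fin P)} (h : S ∈ I.configs l) :
    S.Nonempty := by
  simp only [configs, Finset.mem_filter] at h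
  exact h.2.1

theorem configCost_eq (hassign : ∀ l p, I.assignCost l p = 0) (l : Fin L)
    (S : Finset (Fin P)) : I.configCost l S = I.binCost l := by
  simp [configCost, hassign]

theorem totalCost_eq (hassign : ∀ l p, I.assignCost l p = 0) (y : Finset (Fin L))
    (A : Assignment L P) : I.totalCost y A = ∑ l ∈ y, I.binCost l := by
  simp [totalCost, hassign]

/-- `1 ≤ k` also excludes the default values: an empty supremum or a zero divisor would make `k =
0`. -/
theorem maxCost_pos (hk : 1 ≤ I.k) : 0 < I.maxCost := by
  by_contra h
  have : I.k ≤ 0 := div_nonpos_of_nonneg_of_nonpos I.budget_nonneg (not_lt.1 h)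
  linarith

theorem budget_eq (hk : 1 ≤ I.k) : I.budget = I.k * I.maxCost :=
  (div_mul_cancel₀ _ (maxCost_pos hk).ne').symm

theorem binCost_le_maxCost (hassign : ∀ l p, I.assignCost l p = 0) {l : Fin L}
    {S : Finset (Fin P)} (hS : S ∈ I.configs l) : I.binCost l ≤ I.maxCost := by
  refine le_csSup ?_ ⟨l, S, hS, (configCost_eq hassign l S).symm⟩
  refine ((Set.finite_univ.image fun x : Fin L × Finset (Fin P) =>
    I.configCost x.1 x.2).subset ?_).bddAbove
  rintro _ ⟨l, S, -, rfl⟩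
  exact ⟨(l, S), Set.mem_univ _, rfl⟩

theorem unitCost_nonneg (hk : 1 ≤ I.k) (l : Fin L) (S : Finset (Fin P)) :
    0 ≤ I.unitCost l S := by
  have := maxCost_pos hk
  unfold unitCost
  split_ifs
  · exact div_nonneg (le_min (I.binCost_nonneg l) this.le) this.le
  · exact le_rfl

theorem unitCost_le_one (hk : 1 ≤ I.k) (l : Fin L) (S : Finset (Fin P)) :
    I.unitCost l S ≤ 1 := by
  have := maxCost_pos hk
  unfold unitCost
  split_ifs
  · exact (div_le_one this).2 (min_le_right _ _)
  · exact zero_le_one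

theorem maxCost_mul_unitCost (hassign : ∀ l p, I.assignCost l p = 0) (hk : 1 ≤ I.k) {l : Fin L}
    {S : Finset (Fin P)} (hS : S ∈ I.configs l) :
    I.maxCost * I.unitCost l S = I.binCost l := by
  rw [unitCost, if_pos (nonempty_of_mem_configs hS), min_eq_left (binCost_le_maxCost hassign hS)]
  exact mul_div_cancel₀ _ (maxCost_pos hk).ne'

/-! ### The law of the draw and its link to the linear program. -/

section Draw

variable {X : Fin L → Finset (Fin P) → ℝ}

theorem drawProb_nonneg (hX : I.LPFeasible X) (l : Fin L) (S : Finset (Fin P)) :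
    0 ≤ I.drawProb X l S := by
  unfold drawProb
  split_ifs with h1 h2
  · linarith [hX.one_config l]
  · exact hX.nonneg l S h2
  · exact le_rfl

theorem sum_drawProb_mul {l : Fin L} {f : Finset (Fin P) → ℝ} (hf : f ∅ = 0) :
    ∑ S, I.drawProb X l S * f S = ∑ S ∈ I.configs l, X l S * f S := by
  symm
  refine Finset.sum_subset_zero_on_sdiff (Finset.subset_univ _) (fun S hS => ?_) fun S hS => ?_
  · rcases eq_or_ne S ∅ with rfl | hne
    · rw [hf, mul_zero]
    · rw [drawProb, if_neg hne, if_neg (Finset.mem_sdiff.1 hS).2, zero_mul]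
  · rw [drawProb, if_neg (nonempty_of_mem_configs hS).ne_empty, if_pos hS]

theorem sum_drawProb (l : Fin L) : ∑ S, I.drawProb X l S = 1 := by
  have h : ∀ S, I.drawProb X l S
      = I.drawProb X l S * (if S.Nonempty then 1 else 0)
        + if S = ∅ then 1 - ∑ S' ∈ I.configs l, X l S' else 0 := by
    intro S
    rcases S.eq_empty_or_nonempty with rfl | hS
    · simp [drawProb]
    · simp [hS, hS.ne_empty]
  rw [Finset.sum_congr rfl fun S _ => h S, Finset.sum_add_distrib,
    sum_drawProb_mul (by simp), Finset.sum_ite_eq' Finset.univ ∅, if_pos (Finset.mem_univ _)]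
  rw [Finset.sum_congr rfl fun S hS => by
    rw [if_pos (nonempty_of_mem_configs hS), mul_one]]
  ring

theorem isDraw_of_drawProb_ne_zero {T : Assignment L P} (h : ∀ l, I.drawProb X l (T l) ≠ 0) :
    I.IsDraw T := by
  intro l
  by_contra hT
  rw [Finset.mem_insert, not_or] at hT
  exact h l (by rw [drawProb, if_neg hT.1, if_neg hT.2])

theorem sum_drawProb_mul_unitCost (hassign : ∀ l p, I.assignCost l p = 0) (hk : 1 ≤ I.k)
    (l : Fin L) :
    I.maxCost * ∑ S, I.drawProb X l S * I.unitCost l S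
      = I.binCost l * ∑ S ∈ I.configs l, X l S := by
  rw [sum_drawProb_mul (by simp [unitCost]), Finset.mul_sum, Finset.mul_sum]
  refine Finset.sum_congr rfl fun S hS => ?_
  rw [← maxCost_mul_unitCost hassign hk hS]
  ring

theorem sum_drawProb_mul_mem (l : Fin L) (p : Fin P) :
    ∑ S, I.drawProb X l S * (if p ∈ S then 1 else 0)
      = ∑ S ∈ (I.configs l).filter (fun S => p ∈ S), X l S := by
  rw [sum_drawProb_mul (by simp), Finset.sum_filter]
  exact Finset.sum_congr rfl fun S _ => by split_ifs <;> simp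

/-- The reward of bin `l` in the linear program. -/
theorem sum_mul_reward_eq (l : Fin L) :
    ∑ S ∈ I.configs l, X l S * ∑ p ∈ S, I.reward l p
      = ∑ p, I.reward l p * ∑ S ∈ (I.configs l).filter (fun S => p ∈ S), X l S := by
  simp only [Finset.mul_sum, Finset.sum_filter, mul_ite, mul_zero]
  rw [Finset.sum_comm]
  refine Finset.sum_congr rfl fun S _ => ?_
  rw [← Finset.sum_filter]
  exact Finset.sum_congr (by simp) fun p _ => mul_comm _ _

theorem lpValue_eq (X : Fin L → Finset (Fin P) → ℝ) :
    I.lpValue X = ∑ l, ∑ S ∈ I.configs l, X l S * ∑ p ∈ S, I.reward l p := by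
  simp only [sum_mul_reward_eq]
  simp only [lpValue, Finset.mul_sum]
  exact Finset.sum_comm

/-- Cross-multiplication survives zero denominators: if only the denominator of `l'` vanishes, its
numerator does too, since otherwise its ratio would be `∞`. -/
theorem mul_le_mul_of_ratio_le (hX : I.LPFeasible X) {l l' : Fin L}
    (h : I.ratio X l' ≤ I.ratio X l) :
    (∑ S ∈ I.configs l', X l' S * ∑ p ∈ S, I.reward l' p)
        * (I.binCost l * ∑ S ∈ I.configs l, X l S)
      ≤ (∑ S ∈ I.configs l, X l S * ∑ p ∈ S, I.reward l p)
        * (I.binCost l' * ∑ S ∈ I.configs l', X l' S) := by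
  have ha : ∀ l, 0 ≤ ∑ S ∈ I.configs l, X l S * ∑ p ∈ S, I.reward l p := fun l =>
    Finset.sum_nonneg fun S hS =>
      mul_nonneg (hX.nonneg l S hS) (Finset.sum_nonneg fun p _ => I.reward_nonneg l p)
  have hb : ∀ l, 0 ≤ I.binCost l * ∑ S ∈ I.configs l, X l S := fun l =>
    mul_nonneg (I.binCost_nonneg l) (Finset.sum_nonneg fun S hS => hX.nonneg l S hS)
  unfold ratio at h
  generalize (∑ S ∈ I.configs l', X l' S * ∑ p ∈ S, I.reward l' p) = a', ha l' = ha' at h ⊢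
  generalize (∑ S ∈ I.configs l, X l S * ∑ p ∈ S, I.reward l p) = a, ha l = ha at h ⊢
  generalize (I.binCost l' * ∑ S ∈ I.configs l', X l' S) = b', hb l' = hb' at h ⊢
  generalize (I.binCost l * ∑ S ∈ I.configs l, X l S) = b, hb l = hb at h ⊢
  rcases hb.eq_or_lt with rfl | hbpos
  · simpa using mul_nonneg ha hb'
  rcases hb'.eq_or_lt with rfl | hbpos'
  · rcases ha'.eq_or_lt with rfl | hapos'
    · simp
    · rw [ENNReal.ofReal_zero, ENNReal.div_zero (ENNReal.ofReal_pos.2 hapos').ne',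
        ← ENNReal.ofReal_div_of_pos hbpos] at h
      exact absurd (top_le_iff.1 h) ENNReal.ofReal_ne_top
  · rw [← ENNReal.ofReal_div_of_pos hbpos, ← ENNReal.ofReal_div_of_pos hbpos',
      ENNReal.ofReal_le_ofReal_iff (div_nonneg ha hb), div_le_div_iff₀ hbpos' hbpos] at h
    exact h

end Draw

/-! ### Feasibility and pointwise value of the output. -/

section Output

variable {σ : Equiv.Perm (Fin L)} {T A : Assignment L P}

theorem greedy_subset (l : Fin L) : I.greedy σ T l ⊆ T l := by
  unfold greedy
  split_ifs
  · exact subset_rfl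
  · exact Finset.empty_subset _

theorem binsOf_greedy_subset (p : Fin P) : binsOf (I.greedy σ T) p ⊆ binsOf T p := by
  intro l hl
  simp only [binsOf, Finset.mem_filter, Finset.mem_univ, true_and] at hl ⊢
  exact greedy_subset l hl

theorem Trim.apply_subset {G : Assignment L P} (h : I.Trim G A) (l : Fin L) : A l ⊆ G l := by
  intro p hp
  have := h.subset p (show l ∈ binsOf A p by simpa [binsOf] using hp)
  simpa [binsOf] using this

theorem IsDraw.mem_configs (hT : I.IsDraw T) {l : Fin L} (h : (T l).Nonempty) :
    T l ∈ I.configs l :=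
  (Finset.mem_insert.1 (hT l)).resolve_left h.ne_empty

theorem IsDraw.weight_le (hT : I.IsDraw T) (l : Fin L) (i : Fin (I.dim l)) :
    ∑ p ∈ T l, I.weight l p i ≤ I.cap l i := by
  rcases (T l).eq_empty_or_nonempty with h | h
  · simp [h]
  · have := hT.mem_configs h
    simp only [configs, Finset.mem_filter] at this
    exact this.2.2 i

/-- The bins that receive a set respect the budget. -/
theorem sum_binCost_le_budget_of_subset_greedy (hT : I.IsDraw T)
    (hA : ∀ l, A l ⊆ I.greedy σ T l) : ∑ l ∈ openBins A, I.binCost l ≤ I.budget := by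
  rcases (openBins A).eq_empty_or_nonempty with h | h
  · rw [h, Finset.sum_empty]
    exact I.budget_nonneg
  -- Take the open bin in the last position: its nonnegative residual has already paid for all open
  -- bins.
  · obtain ⟨m, hm, hmax⟩ := Finset.exists_max_image _ (fun l => σ.symm l) h
    have hopen : ∀ l ∈ openBins A, T l ∈ I.configs l := fun l hl =>
      hT.mem_configs (((Finset.mem_filter.1 hl).2.mono (hA l)).mono (greedy_subset l))
    have hres : 0 ≤ I.residual σ T (σ.symm m) := by
      have := (Finset.mem_filter.1 hm).2.mono (hA m)
      by_contra hneg
      rw [greedy, if_neg hneg] at this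
      exact Finset.not_nonempty_empty this
    refine le_trans ?_ (sub_nonneg.1 hres)
    calc ∑ l ∈ openBins A, I.binCost l
        = ∑ i ∈ (openBins A).map σ.symm.toEmbedding, I.binCost (σ i)
            * (if T (σ i) ∈ I.configs (σ i) then 1 else 0) := by
          rw [Finset.sum_map]
          refine Finset.sum_congr rfl fun l hl => ?_
          simp [hopen l hl]
      _ ≤ _ := by
          refine Finset.sum_le_sum_of_subset_of_nonneg (fun i hi => ?_) fun i _ _ => ?_
          · obtain ⟨l, hl, rfl⟩ := Finset.mem_map.1 hi
            exact Finset.mem_Iic.2 (hmax l hl)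
          · exact mul_nonneg (I.binCost_nonneg _) (by split_ifs <;> norm_num)

theorem IsOutput.feasible (hassign : ∀ l p, I.assignCost l p = 0) (hT : I.IsDraw T)
    (hA : I.IsOutput σ T A) : I.Feasible (openBins A) A := by
  have key : (∀ l, A l ⊆ T l) → (∀ p, (binsOf A p).card ≤ I.mult p) →
      I.totalCost (openBins A) A ≤ I.budget → I.Feasible (openBins A) A :=
    fun h1 h2 h3 => ⟨fun l hl => by simpa [openBins] using hl,
      fun l i => (Finset.sum_le_sum_of_subset (h1 l)).trans (hT.weight_le l i), h2, h3⟩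
  obtain ⟨A₁, h₁, ⟨hcost, rfl⟩ | ⟨-, h₂⟩⟩ := hA
  · exact key h₁.apply_subset (fun p => (h₁.card_eq p).trans_le (min_le_left _ _)) hcost
  · refine key (fun l => (h₂.apply_subset l).trans (greedy_subset l))
      (fun p => (h₂.card_eq p).trans_le (min_le_left _ _)) ?_
    rw [totalCost_eq hassign]
    exact sum_binCost_le_budget_of_subset_greedy hT h₂.apply_subset

/-- A bin receives its set if the total cost of the nonempty bins before it leaves room for the
largest cost. -/
theorem residual_nonneg (hassign : ∀ l p, I.assignCost l p = 0) (hk : 1 ≤ I.k)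
    (hT : I.IsDraw T) (i : Fin L)
    (hi : (∑ j, if j < i then I.unitCost (σ j) (T (σ j)) else 0) ≤ I.k - 1) :
    0 ≤ I.residual σ T i := by
  have hM := maxCost_pos hk
  have hterm : ∀ j, I.binCost (σ j) * (if T (σ j) ∈ I.configs (σ j) then 1 else 0)
      = I.maxCost * I.unitCost (σ j) (T (σ j)) := by
    intro j
    split_ifs with h
    · rw [maxCost_mul_unitCost hassign hk h, mul_one]
    · have : ¬ (T (σ j)).Nonempty := fun hne => h (hT.mem_configs hne)
      rw [unitCost, if_neg this, mul_zero, mul_zero]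
  have hsum : ∑ j, (if j < i then I.unitCost (σ j) (T (σ j)) else 0)
      = ∑ j ∈ Finset.Iio i, I.unitCost (σ j) (T (σ j)) := by
    rw [← Finset.sum_filter]
    exact Finset.sum_congr (by ext; simp) fun _ _ => rfl
  -- The prefix costs at most `k - 1` units and bin `i` itself at most one.
  rw [residual, budget_eq hk, Finset.sum_congr rfl fun j _ => hterm j, ← Finset.mul_sum,
    ← Finset.Iio_insert, Finset.sum_insert (by simp), ← hsum]
  nlinarith [unitCost_le_one hk (σ i) (T (σ i))]

/-- The reward of the returned assignment, from a random choice of the bins that keep an item. -/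
theorem IsOutput.le_value (hassign : ∀ l p, I.assignCost l p = 0) (hk : 1 ≤ I.k)
    (hT : I.IsDraw T) (hA : I.IsOutput σ T A) :
    ∑ l, ∑ p, I.reward l p * ((if p ∈ T l then 1 else 0) *
        ((if (∑ j, if j < σ.symm l then I.unitCost (σ j) (T (σ j)) else 0) ≤ I.k - 1
            then 1 else 0)
          * min 1 ((I.mult p : ℝ)
            / (1 + ∑ l' ∈ Finset.univ.erase l, if p ∈ T l' then 1 else 0))))
      ≤ I.value A := by
  -- Both branches at once: `G` is the assignment before trimming, either the whole draw or its
  -- greedy part.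
  obtain ⟨G, hGA, hGT, hTG⟩ : ∃ G, I.Trim G A ∧ (∀ p, binsOf G p ⊆ binsOf T p) ∧
      ∀ l, 0 ≤ I.residual σ T (σ.symm l) → G l = T l := by
    obtain ⟨A₁, h₁, ⟨-, rfl⟩ | ⟨-, h₂⟩⟩ := hA
    · exact ⟨T, h₁, fun p => subset_rfl, fun l _ => rfl⟩
    · exact ⟨_, h₂, binsOf_greedy_subset, fun l hl => if_pos hl⟩
  rw [value_eq_sum_binsOf, Finset.sum_comm]
  refine Finset.sum_le_sum fun p _ => ?_
  -- Counting the bins of `p` in `T` instead of `G` only weakens the bound, and frees it from the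
  -- greedy selection.
  refine le_trans ?_ (hGA.min_mul_sum_le p (Finset.card_le_card (hGT p)))
  rw [Finset.mul_sum, binsOf, Finset.sum_filter]
  refine Finset.sum_le_sum fun l _ => ?_
  have hm0 : (0 : ℝ) ≤ min 1 ((I.mult p : ℝ) / (binsOf T p).card) :=
    le_min zero_le_one (by positivity)
  have hright : 0 ≤ if p ∈ G l then
      min 1 ((I.mult p : ℝ) / (binsOf T p).card) * I.reward l p else 0 := by
    split_ifs
    · exact mul_nonneg hm0 (I.reward_nonneg l p)
    · exact le_rfl
  by_cases hp : p ∈ T l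
  swap
  · simpa [hp] using hright
  by_cases hc : (∑ j, if j < σ.symm l then I.unitCost (σ j) (T (σ j)) else 0) ≤ I.k - 1
  swap
  · simpa [hc] using hright
  have hG : p ∈ G l := by rwa [hTG l (residual_nonneg hassign hk hT _ hc)]
  have hcard : (1 : ℝ) + ∑ l' ∈ Finset.univ.erase l, (if p ∈ T l' then 1 else 0)
      = (binsOf T p).card := by
    have h := Finset.add_sum_erase Finset.univ (fun l' => if p ∈ T l' then (1 : ℝ) else 0)
      (Finset.mem_univ l)
    rw [if_pos hp] at h
    rw [h, Finset.sum_boole, binsOf]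
  rw [if_pos hp, if_pos hc, if_pos hG, hcard, one_mul, one_mul, mul_comm]

end Output

/-! ### The expected value and the comparison with the optimum. -/

theorem approxFactor_nonneg (hk : 1 ≤ I.k) :
    0 ≤ (I.k - 1) / I.k * (1 - 1 / Real.sqrt I.k) := by
  refine mul_nonneg (div_nonneg (by linarith) (by linarith)) (sub_nonneg.2 ?_)
  exact (div_le_one (Real.sqrt_pos.2 (by linarith))).2 (Real.one_le_sqrt.2 hk)

theorem contentionFactor_nonneg (r : ℕ) : 0 ≤ 1 - 1 / Real.sqrt ((r : ℝ) + 3) := by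
  have h : (1 : ℝ) ≤ Real.sqrt ((r : ℝ) + 3) :=
    Real.one_le_sqrt.2 (by have := r.cast_nonneg (α := ℝ); linarith)
  exact sub_nonneg.2 ((div_le_one (by linarith)).2 h)

/-- The factor increases with the multiplicity, so the smallest one is the worst. -/
theorem contentionFactor_le (p : Fin P) :
    1 - 1 / Real.sqrt ((I.rho : ℝ) + 3) ≤ 1 - 1 / Real.sqrt ((I.mult p : ℝ) + 3) := by
  have h : (I.rho : ℝ) ≤ I.mult p := by
    exact_mod_cast ciInf_le (OrderBot.bddBelow _) p
  refine sub_le_sub_left (one_div_le_one_div_of_le (Real.sqrt_pos.2 (by positivity)) ?_) _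
  exact Real.sqrt_le_sqrt (by linarith)

/-- The expected value of the returned assignment, compared with the linear program. -/
theorem le_expect_value (hassign : ∀ l p, I.assignCost l p = 0) (hk : 1 ≤ I.k)
    {X : Fin L → Finset (Fin P) → ℝ} (hX : I.LPFeasible X) {σ : Equiv.Perm (Fin L)}
    (hσ : I.SortedBy X σ) {out : Assignment L P → Assignment L P}
    (hout : ∀ T, I.IsDraw T → I.IsOutput σ T (out T)) :
    (1 - 1 / Real.sqrt ((I.rho : ℝ) + 3)) * ((I.k - 1) / I.k) * (1 - 1 / Real.sqrt I.k)
        * I.lpValue X ≤ I.expect X (fun T => I.value (out T)) := by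
  set D := I.drawProb X with hD
  set γ := 1 - 1 / Real.sqrt ((I.rho : ℝ) + 3) with hγ
  have hD0 : ∀ l S, 0 ≤ D l S := drawProb_nonneg hX
  have hD1 : ∀ l, ∑ S, D l S = 1 := sum_drawProb
  have hM := maxCost_pos hk
  set x : Fin L → Fin P → ℝ := fun l p =>
    ∑ S ∈ (I.configs l).filter (fun S => p ∈ S), X l S with hx
  have hx0 : ∀ l p, 0 ≤ x l p := fun l p =>
    Finset.sum_nonneg fun S hS => hX.nonneg l S (Finset.mem_filter.1 hS).1
  set φ : Fin L → Assignment L P → ℝ := fun l T =>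
    if (∑ j, if j < σ.symm l then I.unitCost (σ j) (T (σ j)) else 0) ≤ I.k - 1
      then 1 else 0 with hφ
  set ψ : Fin L → Fin P → Assignment L P → ℝ := fun l p T =>
    min 1 ((I.mult p : ℝ)
      / (1 + ∑ l' ∈ Finset.univ.erase l, if p ∈ T l' then 1 else 0)) with hψ
  have hvalue : prodExpect D (fun T => ∑ l, ∑ p, I.reward l p *
      ((if p ∈ T l then 1 else 0) * (φ l T * ψ l p T)))
      ≤ I.expect X (fun T => I.value (out T)) :=
    prodExpect_mono_of_support hD0 fun T hT =>
      (hout T (isDraw_of_drawProb_ne_zero hT)).le_value hassign hk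
        (isDraw_of_drawProb_ne_zero hT)
  have hcond : ∀ l p, prodExpect D (fun T => (if p ∈ T l then 1 else 0) * (φ l T * ψ l p T))
      = x l p * prodExpect D (fun T => φ l T * ψ l p T) := by
    intro l p
    rw [show x l p = _ from (sum_drawProb_mul_mem l p).symm]
    refine prodExpect_apply_mul l (hD1 l) (fun S => if p ∈ S then 1 else 0) _ fun T S => ?_
    have e1 : φ l (Function.update T l S) = φ l T := by
      have : (∑ j, if j < σ.symm l then
            I.unitCost (σ j) (Function.update T l S (σ j)) else 0)
          = ∑ j, if j < σ.symm l then I.unitCost (σ j) (T (σ j)) else 0 :=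
        Finset.sum_congr rfl fun j _ => by
          split_ifs with hj
          · rw [Function.update_of_ne]
            rintro rfl
            simp at hj
          · rfl
      simp only [hφ, this]
    have e2 : ψ l p (Function.update T l S) = ψ l p T := by
      have : (∑ l' ∈ Finset.univ.erase l,
            if p ∈ Function.update T l S l' then (1 : ℝ) else 0)
          = ∑ l' ∈ Finset.univ.erase l, if p ∈ T l' then 1 else 0 :=
        Finset.sum_congr rfl fun l' hl' => by
          rw [Function.update_of_ne (Finset.ne_of_mem_erase hl')]
      simp only [hψ, this]
    rw [e1, e2]
  have hmean : ∀ l p, γ ≤ prodExpect D (ψ l p) := by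
    intro l p
    refine (contentionFactor_le p).trans (le_prodExpect_min_one_div hD0 hD1
      (Finset.univ.erase l) (fun _ S => if p ∈ S then 1 else 0)
      (fun _ S => by split_ifs <;> norm_num) (fun _ S => by split_ifs <;> norm_num)
      (I.mult_pos p) ?_)
    simp only [hD, sum_drawProb_mul_mem]
    refine le_trans ?_ (hX.multiplicity p)
    exact Finset.sum_le_sum_of_subset_of_nonneg (Finset.erase_subset _ _)
      fun l' _ _ => hx0 l' p
  have hφ0 : ∀ l, 0 ≤ prodExpect D (φ l) := by
    intro l
    rw [← prodExpect_const hD1 0]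
    exact prodExpect_mono hD0 fun T => by simp only [hφ]; split_ifs <;> norm_num
  have hharris : ∀ l p, prodExpect D (φ l) * prodExpect D (ψ l p)
      ≤ prodExpect D (fun T => φ l T * ψ l p T) := by
    intro l p
    refine prodExpect_mul_le_of_antitone hD0 hD1
      -- The events `p ∈ S` and `S` nonempty are nested, so a single rank in `{0, 1, 2}` makes `φ l`
      -- and `ψ l p` both nonincreasing.
      (fun S => (if S.Nonempty then 1 else 0) + if p ∈ S then 1 else 0) ?_ ?_
    · intro T T' hTT
      have hle : (∑ j, if j < σ.symm l then I.unitCost (σ j) (T (σ j)) else 0)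
          ≤ ∑ j, if j < σ.symm l then I.unitCost (σ j) (T' (σ j)) else 0 := by
        refine Finset.sum_le_sum fun j _ => ?_
        split_ifs with hj
        · rcases (T (σ j)).eq_empty_or_nonempty with h | h
          · rw [h]
            exact (if_neg Finset.not_nonempty_empty).trans_le (unitCost_nonneg hk _ _)
          · have h' : (T' (σ j)).Nonempty := by
              by_contra hne
              have := hTT (σ j)
              rw [Finset.not_nonempty_iff_eq_empty.1 hne] at this
              simp [h] at this
            rw [unitCost, unitCost, if_pos h, if_pos h']
        · exact le_rfl
      simp only [hφ]
      split_ifs with h1 h2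
      · exact le_rfl
      · exact absurd (hle.trans h1) h2
      · exact zero_le_one
      · exact le_rfl
    · intro T T' hTT
      have hle : (∑ l' ∈ Finset.univ.erase l, if p ∈ T l' then (1 : ℝ) else 0)
          ≤ ∑ l' ∈ Finset.univ.erase l, if p ∈ T' l' then 1 else 0 := by
        refine Finset.sum_le_sum fun l' _ => ?_
        have := hTT l'
        by_cases h : p ∈ T l'
        · have h' : p ∈ T' l' := by
            by_contra hne
            have h3 : (T l').Nonempty := ⟨p, h⟩
            simp only [h, h3, hne, if_true, if_false] at this
            split_ifs at this <;> omega
          simp [h, h']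
        · rw [if_neg h]
          split_ifs <;> norm_num
      have hpos : (0 : ℝ) ≤ ∑ l' ∈ Finset.univ.erase l, if p ∈ T l' then (1 : ℝ) else 0 :=
        Finset.sum_nonneg fun _ _ => by split_ifs <;> norm_num
      exact min_le_min le_rfl (div_le_div_of_nonneg_left (Nat.cast_nonneg _) (by linarith)
        (by linarith))
  set w : Fin L → ℝ := fun l => ∑ S ∈ I.configs l, X l S * ∑ p ∈ S, I.reward l p with hw
  have hw0 : ∀ l, 0 ≤ w l := fun l => Finset.sum_nonneg fun S hS =>
    mul_nonneg (hX.nonneg l S hS) (Finset.sum_nonneg fun p _ => I.reward_nonneg l p)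
  have hbudget : ∑ l, ∑ S, D l S * I.unitCost l S ≤ I.k := by
    refine le_of_mul_le_mul_left ?_ hM
    rw [Finset.mul_sum, mul_comm I.maxCost I.k, ← budget_eq hk]
    refine le_trans (le_of_eq ?_) hX.withinBudget
    refine Finset.sum_congr rfl fun l _ => ?_
    rw [hD, sum_drawProb_mul_unitCost hassign hk, Finset.mul_sum]
    exact Finset.sum_congr rfl fun S _ => by rw [configCost_eq hassign]
  have hgreedy : (I.k - 1) / I.k * (1 - 1 / Real.sqrt I.k) * ∑ l, w l
      ≤ ∑ i, w (σ i) * prodExpect D (φ (σ i)) := by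
    have := le_sum_mul_prodExpect_prefix hD0 hD1 I.unitCost (unitCost_nonneg hk)
      (unitCost_le_one hk) σ hk hbudget hw0 fun i j hij => by
        have h := mul_le_mul_of_ratio_le hX (hσ i j hij)
        rw [← sum_drawProb_mul_unitCost hassign hk, ← sum_drawProb_mul_unitCost hassign hk] at h
        refine le_of_mul_le_mul_left ?_ hM
        calc _ = _ := mul_left_comm _ _ _
          _ ≤ _ := h
          _ = _ := mul_left_comm _ _ _
    simpa only [hφ, Equiv.symm_apply_apply] using this
  calc γ * ((I.k - 1) / I.k) * (1 - 1 / Real.sqrt I.k) * I.lpValue X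
      = γ * ((I.k - 1) / I.k * (1 - 1 / Real.sqrt I.k) * ∑ l, w l) := by
        rw [lpValue_eq]
        ring
    _ ≤ γ * ∑ i, w (σ i) * prodExpect D (φ (σ i)) :=
        mul_le_mul_of_nonneg_left hgreedy (contentionFactor_nonneg _)
    _ = ∑ l, ∑ p, I.reward l p * (x l p * (prodExpect D (φ l) * γ)) := by
        rw [Equiv.sum_comp σ fun l => w l * prodExpect D (φ l), Finset.mul_sum]
        refine Finset.sum_congr rfl fun l _ => ?_
        rw [hw]
        simp only [sum_mul_reward_eq]
        rw [Finset.sum_mul, Finset.mul_sum]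
        exact Finset.sum_congr rfl fun p _ => by ring
    _ ≤ ∑ l, ∑ p, I.reward l p * (x l p * prodExpect D (fun T => φ l T * ψ l p T)) := by
        refine Finset.sum_le_sum fun l _ => Finset.sum_le_sum fun p _ =>
          mul_le_mul_of_nonneg_left (mul_le_mul_of_nonneg_left ?_ (hx0 l p))
            (I.reward_nonneg l p)
        exact (mul_le_mul_of_nonneg_left (hmean l p) (hφ0 l)).trans (hharris l p)
    _ = prodExpect D (fun T => ∑ l, ∑ p, I.reward l p *
          ((if p ∈ T l then 1 else 0) * (φ l T * ψ l p T))) := by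
        rw [prodExpect_sum]
        refine Finset.sum_congr rfl fun l _ => ?_
        rw [prodExpect_sum]
        refine Finset.sum_congr rfl fun p _ => ?_
        rw [prodExpect_const_mul, hcond]
    _ ≤ _ := hvalue

/-- A feasible solution yields a feasible solution of the linear program of the same value. -/
theorem Feasible.value_le_lpValue (hassign : ∀ l p, I.assignCost l p = 0)
    {X : Fin L → Finset (Fin P) → ℝ} (hX : I.LPOptimal X) {y : Finset (Fin L)}
    {A : Assignment L P} (hA : I.Feasible y A) : I.value A ≤ I.lpValue X := by
  -- The indicator of `A`; its entry at `∅` is harmless because `∅` is not a configuration.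
  set Y : Fin L → Finset (Fin P) → ℝ := fun l S => if S = A l then 1 else 0 with hY
  have hmem : ∀ l, (A l).Nonempty → A l ∈ I.configs l := fun l h => by
    simpa [configs, h] using hA.capacity l
  have hY01 : ∀ l S, 0 ≤ Y l S ∧ Y l S ≤ 1 := fun l S => by
    simp only [hY]
    split_ifs <;> norm_num
  have hsum : ∀ l (s : Finset (Finset (Fin P))) (f : Finset (Fin P) → ℝ),
      ∑ S ∈ s, f S * Y l S = if A l ∈ s then f (A l) else 0 := fun l s f => by
    simp [hY, Finset.sum_ite_eq']
  have hfeas : I.LPFeasible Y := by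
    refine ⟨fun l S _ => (hY01 l S).1, fun l S _ => (hY01 l S).2, fun l => ?_, fun p => ?_, ?_⟩
    · have := hsum l (I.configs l) fun _ => 1
      simp only [one_mul] at this
      rw [this]
      split_ifs <;> norm_num
    · have hle : ∀ l, ∑ S ∈ (I.configs l).filter (fun S => p ∈ S), Y l S
          ≤ if p ∈ A l then 1 else 0 := fun l => by
        have := hsum l ((I.configs l).filter fun S => p ∈ S) fun _ => 1
        simp only [one_mul] at this
        rw [this]
        by_cases hp : p ∈ A l
        · rw [if_pos hp]
          split_ifs <;> norm_num
        · simp [hp]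
      refine (Finset.sum_le_sum fun l _ => hle l).trans ?_
      rw [Finset.sum_boole]
      exact_mod_cast hA.multiplicity p
    · refine le_trans ?_ ((totalCost_eq hassign y A).symm.trans_le hA.withinBudget)
      rw [← Finset.sum_filter_add_sum_filter_not Finset.univ (fun l => l ∈ y)]
      have h2 : ∑ l ∈ Finset.univ.filter (fun l => ¬ l ∈ y), ∑ S ∈ I.configs l,
          I.configCost l S * Y l S = 0 := by
        refine Finset.sum_eq_zero fun l hl => ?_
        rw [hsum, if_neg]
        intro h
        exact (Finset.mem_filter.1 hl).2 (hA.utilized l (nonempty_of_mem_configs h))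
      rw [h2, add_zero]
      have h3 : Finset.univ.filter (fun l => l ∈ y) = y := by ext; simp
      rw [h3]
      refine Finset.sum_le_sum fun l _ => ?_
      rw [hsum, configCost_eq hassign]
      split_ifs
      · exact le_rfl
      · exact I.binCost_nonneg l
  refine le_trans (le_of_eq ?_) (hX.2 Y hfeas)
  rw [lpValue_eq, value]
  refine Finset.sum_congr rfl fun l _ => ?_
  rw [Finset.sum_congr rfl fun S _ => mul_comm (Y l S) _, hsum]
  split_ifs with h
  · rfl
  · have : ¬ (A l).Nonempty := fun hne => h (hmem l hne)
    rw [Finset.not_nonempty_iff_eq_empty.1 this, Finset.sum_empty]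

end Inst

end BudgetedAssignment

theorem theorem5 {L P : ℕ} (I : BudgetedAssignment.Inst L P)
    -- there are no assignment costs
    (hassign : ∀ l p, I.assignCost l p = 0)
    -- every single configuration fits into the budget, and not all of them are free
    (hk : 1 ≤ I.k)
    -- the optimal solution of the relaxation and the order of the bins used by the algorithm
    (X : Fin L → Finset (Fin P) → ℝ) (hX : I.LPOptimal X)
    (σ : Equiv.Perm (Fin L)) (hσ : I.SortedBy X σ)
    -- the assignment returned on each draw, with any rule to break ties
    (out : BudgetedAssignment.Assignment L P → BudgetedAssignment.Assignment L P)
    (hout : ∀ T, I.IsDraw T → I.IsOutput σ T (out T)) :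
    (∀ T, I.IsDraw T → I.Feasible (BudgetedAssignment.openBins (out T)) (out T)) ∧
    (1 - 1 / Real.sqrt ((I.rho : ℝ) + 3)) * ((I.k - 1) / I.k) * (1 - 1 / Real.sqrt I.k)
        * I.lpValue X ≤ I.expect X (fun T => I.value (out T)) ∧
    (∀ (y : Finset (Fin L)) (A : BudgetedAssignment.Assignment L P), I.Feasible y A →
      (1 - 1 / Real.sqrt ((I.rho : ℝ) + 3)) * ((I.k - 1) / I.k) * (1 - 1 / Real.sqrt I.k)
        * I.value A ≤ I.expect X (fun T => I.value (out T))) := by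
  have hlp := BudgetedAssignment.Inst.le_expect_value hassign hk hX.1 hσ hout
  refine ⟨fun T hT => (hout T hT).feasible hassign hT, hlp, fun y A hA => le_trans ?_ hlp⟩
  refine mul_le_mul_of_nonneg_left (hA.value_le_lpValue hassign hX) ?_
  rw [mul_assoc]
  exact mul_nonneg (BudgetedAssignment.Inst.contentionFactor_nonneg _)
    (BudgetedAssignment.Inst.approxFactor_nonneg hk)
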